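/- Let $U=\{z\in\mathbb C:|z|<1\}$ and let $B$ be the set of analytic functions $a$ on $U$ with $|a(z)|<1$ for all $z\in U$. A mapping $f$ on $U$ is logharmonic with respect to $a\in B$ if it solves $\overline{f_{\bar z}}/\overline f=a\,f_z/f$ on $U$ (away from the zeros of $f$). Let $0\le\alpha<1$. $ST_{Lh}(\alpha)$ denotes the set of univalent logharmonic mappings $f(z)=z\,h(z)\overline{g(z)}$ on $U$, with $h,g$ analytic on $U$, $0\notin (hg)(U)$ and $g(0)=1$, such that $$\frac{\partial \arg f(re^{i\theta})}{\partial\theta}=\operatorname{Re}\frac{zf_z-\bar z f_{\bar z}}{f}>\alpha\qquad (z=re^{i\theta},\ 0<r<1).$$ $P_{Lh}$ denotes the set of logharmonic mappings $R=H\overline G$ on $U$ with $H,G$ analytic on $U$, $H(0)=G(0)=1$ and $\operatorname{Re}R>0$ on $U$. $CST_{Lh}(\alpha)$ denotes the set of products $F=fR$ with $f\in ST_{Lh}(\alpha)$ and $R\in P_{Lh}$ logharmonic with respect to the same $a\in B$; we then say that $F$ belongs to $CST_{Lh}(\alpha)$ with respect to $a$. Put $$\rho_\alpha=\frac{2-\alpha-\sqrt{\alpha^2-2\alpha+3}}{1-2\alpha}\quad(\alpha\ne\tfrac12),\qquad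 \rho_{1/2}=\tfrac13 .$$ **Theorem.** If $F\in CST_{Lh}(\alpha)$ and $0<\rho\le\rho_\alpha$, then $F$ is univalent in the disk $|z|<\rho$ and maps it onto a domain that is starlike with respect to the origin. The bound $\rho_\alpha$ is best possible for every $a\in B$ with $a(0)=0$: for each such $a$ there is a mapping $F$ in $CST_{Lh}(\alpha)$ with respect to $a$ which is not univalent in $|z|<r$ for any $r\in(\rho_\alpha,1]$. (The condition $a(0)=0$ is automatic for the dilatation $a$ of any $f\in ST_{Lh}(\alpha)$.) -/

import Mathlib

open scoped ComplexConjugate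

noncomputable section

namespace Logharmonic

/-- The open unit disk `U`. -/
def unitDisk : Set ℂ := Metric.ball 0 1

/-- The Wirtinger derivative `f_z = (f_x - i f_y) / 2`. -/
def wirtingerZ (f : ℂ → ℂ) (z : ℂ) : ℂ :=
  (fderiv ℝ f z 1 - Complex.I * fderiv ℝ f z Complex.I) / 2

/-- The Wirtinger derivative `f_{z̄} = (f_x + i f_y) / 2`. -/
def wirtingerZbar (f : ℂ → ℂ) (z : ℂ) : ℂ :=
  (fderiv ℝ f z 1 + Complex.I * fderiv ℝ f z Complex.I) / 2

/-- The class `B` of analytic functions `a` on `U` with `|a| < 1`. -/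
def classB : Set (ℂ → ℂ) :=
  {a | DifferentiableOn ℂ a unitDisk ∧ ∀ z ∈ unitDisk, ‖a z‖ < 1}

/-- `f` is logharmonic on `U` with respect to `a`: it is continuous on `U` and, at every point of
`U` where it does not vanish (both sides of the equation divide by `f`), it is continuously
differentiable in the real sense and solves `conj (f_{z̄}) / conj f = a f_z / f`. -/
def IsLogharmonic (a f : ℂ → ℂ) : Prop :=
  ContinuousOn f unitDisk ∧
    ∀ z ∈ unitDisk, f z ≠ 0 →
      ContDiffAt ℝ 1 f z ∧
        conj (wirtingerZbar f z) / conj (f z) = a z * (wirtingerZ f z / f z)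

/-- `∂ arg f(r e^{iθ}) / ∂θ = Re ((z f_z - z̄ f_{z̄}) / f)` at `z = r e^{iθ}`. -/
def argDeriv (f : ℂ → ℂ) (z : ℂ) : ℝ :=
  ((z * wirtingerZ f z - conj z * wirtingerZbar f z) / f z).re

/-- The members of `ST_Lh(α)` with respect to `a`: univalent logharmonic mappings
`f = z h conj(g)`, with `h`, `g` analytic, `0 ∉ (hg)(U)` and `g(0) = 1`, such that
`∂ arg f(r e^{iθ}) / ∂θ > α`. The quotient in `argDeriv` is `0 / 0` at the origin
(it extends there with value `1`), so the inequality is imposed at the other points. -/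
def STLh (a : ℂ → ℂ) (α : ℝ) : Set (ℂ → ℂ) :=
  {f | IsLogharmonic a f ∧ Set.InjOn f unitDisk ∧
    (∃ h g : ℂ → ℂ, DifferentiableOn ℂ h unitDisk ∧ DifferentiableOn ℂ g unitDisk ∧
      (∀ z ∈ unitDisk, h z * g z ≠ 0) ∧ g 0 = 1 ∧
      ∀ z ∈ unitDisk, f z = z * h z * conj (g z)) ∧
    ∀ z ∈ unitDisk, z ≠ 0 → α < argDeriv f z}

/-- The members of `P_Lh` that are logharmonic with respect to `a`: mappings `R = H conj(G)`
with `H`, `G` analytic on `U`, `H(0) = G(0) = 1` and `Re R > 0` on `U`. -/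
def PLh (a : ℂ → ℂ) : Set (ℂ → ℂ) :=
  {R | IsLogharmonic a R ∧
    (∃ H G : ℂ → ℂ, DifferentiableOn ℂ H unitDisk ∧ DifferentiableOn ℂ G unitDisk ∧
      H 0 = 1 ∧ G 0 = 1 ∧ ∀ z ∈ unitDisk, R z = H z * conj (G z)) ∧
    ∀ z ∈ unitDisk, 0 < (R z).re}

/-- The close to starlike mappings of order `α` with respect to a given `a`: products `F = f R`
of `f ∈ ST_Lh(α)` and `R ∈ P_Lh`, both with respect to `a`. -/
def CSTLhWith (a : ℂ → ℂ) (α : ℝ) : Set (ℂ → ℂ) :=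
  {F | ∃ f ∈ STLh a α, ∃ R ∈ PLh a, ∀ z ∈ unitDisk, F z = f z * R z}

/-- The class `CST_Lh(α)` of close to starlike logharmonic mappings of order `α`. -/
def CSTLh (α : ℝ) : Set (ℂ → ℂ) := {F | ∃ a ∈ classB, F ∈ CSTLhWith a α}

/-- A starlike domain (with respect to the origin). -/
def IsStarlikeDomain (S : Set ℂ) : Prop :=
  IsOpen S ∧ (0 : ℂ) ∈ S ∧ StarConvex ℝ 0 S

/-- The radius of univalence and starlikeness. -/
def rho (α : ℝ) : ℝ :=
  if α = 1 / 2 then 1 / 3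
  else (2 - α - Real.sqrt (α ^ 2 - 2 * α + 3)) / (1 - 2 * α)

end Logharmonic

end

/-!
Write `F = f R` with `f = z h ḡ` and `R = H Ḡ`. Then `F = A B̄` with `A = z h H` and `B = g G`
analytic, and the equation of logharmonic mappings is multiplicative: it reads `B'/B = a A'/A`.
The function `ψ = A / B` satisfies `z ψ'/ψ = z (1 - a) A'/A`, and the real part of this quantity
is `∂ arg F / ∂θ`.

*Starlikeness where `Re (z ψ'/ψ) > 0`.* There the Jacobian of `F` is positive, and the velocity
`-(DF)⁻¹ F`, along which the value of `F` shrinks radially, is `-conj (k (1 - a))` up to a positive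
factor, where `k = A'/A`. Hence it points into the disk `|ζ| < |z|`, and a small radial contraction
of the value `F z` is attained at a point of smaller modulus close to `z` (`exists_inward_path`,
`exists_equiv_of_logharmonic`). This gives univalence and starlikeness by compactness. If
`F z = F w` for some `z ≠ w`, then among such pairs in a closed disk one minimises `|z| + |w|`,
because local injectivity keeps them off the diagonal; moving both points inwards contradicts
minimality (`injOn_ball_of_inward`). Similarly the least `t ≥ t₁` for which `t F z` is a value of
`F` on `|ζ| ≤ |z|` must be `t₁` (`isStarlikeDomain_image_of_inward`). No integration of the flow
and no argument principle is needed.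

*The radius.* The quotient `z h / g` is starlike of order `α` and `H / G` has positive real part,
so the Schwarz lemma gives, with `r = |z|`,
`Re (z ψ'/ψ) ≥ (1 - (1 - 2α) r) / (1 + r) - 2r / (1 - r²)`
(`re_ge_of_re_gt`, `norm_logDeriv_mul_le_of_re_pos`). The right-hand side is
`(1 - (4 - 2α) r + (1 - 2α) r²) / (1 - r²)`, which for
`0 ≤ r < 1` is positive exactly when `r < ρ`.

*Sharpness.* Given `a` with `a(0) = 0`, integrating the equations for `g'/g` and `G'/G` yields
`f` and `R` with dilatation `a`, `z h / g = z / (1 - z)^{2 - 2α}` and `H / G = (1 + z) / (1 - z)`;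
univalence of `f` follows from the criterion above. On the negative axis `F` is real, and its
derivative there is a positive multiple of a real function that changes sign at `-ρ`; so `F` is not
injective on any segment `(-r, 0)` with `r > ρ`.
-/

namespace Logharmonic

open Filter Topology Metric Set

/-! ### A criterion for univalence and starlikeness -/

/-- If `F` is a local diffeomorphism at `z` and the velocity `-(DF)⁻¹ (F z)`, which contracts `F z`
radially, points into the disk `|ζ| < |z|`, then the values `(1 - ε) F z` for small `ε > 0` are
taken at points of that disk close to `z`. -/
lemma exists_inward_path {F : ℂ → ℂ} {z : ℂ} {L : ℂ ≃L[ℝ] ℂ}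
    (hF : HasStrictFDerivAt F (L : ℂ →L[ℝ] ℂ) z) (hz : 0 < (L.symm (F z) * conj z).re) :
    ∃ u : ℝ → ℂ, Tendsto u (𝓝[>] 0) (𝓝 z) ∧
      ∀ᶠ ε : ℝ in 𝓝[>] 0, F (u ε) = (1 - ε : ℝ) • F z ∧ ‖u ε‖ < ‖z‖ := by
  set γ : ℝ → ℂ := fun ε => (1 - ε) • F z
  have hγ : HasDerivAt γ (-F z) 0 := by
    have h := ((hasDerivAt_id (0 : ℝ)).const_sub 1).smul_const (F z)
    rw [neg_one_smul] at h
    exact h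
  have hγ0 : γ 0 = F z := by simp [γ]
  set u : ℝ → ℂ := fun ε => hF.localInverse F L z (γ ε)
  have hu0 : u 0 = z := by simp only [u, hγ0]; exact hF.localInverse_apply_image
  have hu : HasDerivAt u (-L.symm (F z)) 0 := by
    have h := hF.to_localInverse.hasFDerivAt
    rw [← hγ0] at h
    have h' := h.comp_hasDerivAt (0 : ℝ) hγ
    rw [ContinuousLinearEquiv.coe_coe, map_neg] at h'
    exact h'
  have hsq := hu.norm_sq
  rw [hu0] at hsq
  have hneg : 2 * inner ℝ z (-L.symm (F z)) < 0 := by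
    rw [inner_neg_right, Complex.inner]
    simp only [Complex.mul_re, Complex.conj_re, Complex.conj_im] at hz ⊢
    linarith
  refine ⟨u, ?_, ?_⟩
  · have := hu.continuousAt.tendsto
    rw [hu0] at this
    exact this.mono_left nhdsWithin_le_nhds
  · have hev : ∀ᶠ ε in 𝓝 (0 : ℝ), F (u ε) = γ ε := by
      have h1 := hF.eventually_right_inverse
      rw [← hγ0] at h1
      exact hγ.continuousAt.tendsto.eventually h1
    have hsl := (hasDerivAt_iff_tendsto_slope.1 hsq).eventually (gt_mem_nhds hneg)
    filter_upwards [nhdsWithin_le_nhds hev, nhdsGT_le_nhdsNE _ hsl, self_mem_nhdsWithin]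
      with ε h1 h2 h3
    refine ⟨h1, ?_⟩
    have h3' : (0 : ℝ) < ε := h3
    simp only [slope_def_field, sub_zero, hu0] at h2
    rw [div_neg_iff] at h2
    refine lt_of_pow_lt_pow_left₀ 2 (norm_nonneg _) ?_
    rcases h2 with h2 | h2 <;> linarith [h2.1, h2.2]

/-- Among all pairs of distinct points of a closed disk with the same image, one minimises
`|z| + |w|`; moving both points inwards so that their common image shrinks radially
gives a smaller pair. -/
theorem injOn_ball_of_inward {F : ℂ → ℂ} {r : ℝ} (hF0 : F 0 = 0)
    (hne : ∀ z ∈ ball (0 : ℂ) r, z ≠ 0 → F z ≠ 0)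
    (hd : ∀ z ∈ ball (0 : ℂ) r, ∃ L : ℂ ≃L[ℝ] ℂ, HasStrictFDerivAt F (L : ℂ →L[ℝ] ℂ) z ∧
      (z ≠ 0 → 0 < (L.symm (F z) * conj z).re)) :
    InjOn F (ball 0 r) := by
  have hcont : ContinuousOn F (ball 0 r) := fun z hz => by
    obtain ⟨L, hL, -⟩ := hd z hz
    exact hL.continuousAt.continuousWithinAt
  intro z₀ hz₀ w₀ hw₀ heq
  by_contra hzw
  set s := max ‖z₀‖ ‖w₀‖
  have hs : s < r := max_lt (by simpa using hz₀) (by simpa using hw₀)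
  set K := closedBall (0 : ℂ) s
  have hK : IsCompact K := isCompact_closedBall 0 s
  have hKr : K ⊆ ball 0 r := closedBall_subset_ball hs
  set W := interior {p : ℂ × ℂ | F p.1 = F p.2 → p.1 = p.2}
  set S := {p : ℂ × ℂ | p ∈ K ×ˢ K ∧ F p.1 = F p.2}
  have hSclosed : IsClosed S := by
    have h1 : ContinuousOn (fun p : ℂ × ℂ => F p.1 - F p.2) (K ×ˢ K) :=
      ((hcont.mono hKr).comp continuousOn_fst fun p hp => hp.1).sub
        ((hcont.mono hKr).comp continuousOn_snd fun p hp => hp.2)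
    convert h1.preimage_isClosed_of_isClosed (hK.prod hK).isClosed (isClosed_singleton (x := 0))
      using 1
    ext p
    simp [S, sub_eq_zero]
  have hT : IsCompact (S \ W) :=
    ((hK.prod hK).of_isClosed_subset hSclosed fun p hp => hp.1).diff isOpen_interior
  -- Local injectivity of `F` keeps the pairs in `S \ W` off the diagonal.
  have hmem : ∀ p : ℂ × ℂ, p ∈ S \ W ↔ p ∈ S ∧ p.1 ≠ p.2 := by
    rintro ⟨z, w⟩
    refine ⟨fun h => ⟨h.1, fun hzw' => h.2 ?_⟩, fun h => ⟨h.1, fun hW => ?_⟩⟩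
    · dsimp only at hzw'
      subst hzw'
      obtain ⟨L, hL, -⟩ := hd z (hKr h.1.1.1)
      rw [mem_interior_iff_mem_nhds]
      have hs := hL.toOpenPartialHomeomorph F |>.open_source.mem_nhds
        hL.mem_toOpenPartialHomeomorph_source
      filter_upwards [prod_mem_nhds hs hs] with p hp h
      exact (hL.toOpenPartialHomeomorph F).injOn hp.1 hp.2 h
    · exact h.2 (interior_subset hW h.1.2)
  obtain ⟨⟨z, w⟩, hp, hmin⟩ := hT.exists_isMinOn
    ⟨(z₀, w₀), (hmem _).2 ⟨⟨⟨by simp [K, s], by simp [K, s]⟩, heq⟩, hzw⟩⟩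
    (f := fun p : ℂ × ℂ => ‖p.1‖ + ‖p.2‖) (by fun_prop)
  obtain ⟨⟨⟨hz, hw⟩, hFzw⟩, hzw'⟩ := (hmem _).1 hp
  dsimp only at hz hw hFzw hzw'
  have hz0 : z ≠ 0 := by
    rintro rfl
    exact hne w (hKr hw) hzw'.symm (by rw [← hFzw, hF0])
  have hw0 : w ≠ 0 := by
    rintro rfl
    exact hne z (hKr hz) hzw' (by rw [hFzw, hF0])
  obtain ⟨L, hL, hLz⟩ := hd z (hKr hz)
  obtain ⟨M, hM, hMw⟩ := hd w (hKr hw)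
  obtain ⟨u, hu, hu'⟩ := exists_inward_path hL (hLz hz0)
  obtain ⟨v, hv, hv'⟩ := exists_inward_path hM (hMw hw0)
  obtain ⟨ε, huv, ⟨hu1, hu2⟩, hv1, hv2⟩ :=
    (((hu.sub hv).eventually_ne (sub_ne_zero.2 hzw')).and (hu'.and hv')).exists
  have hz' : ‖z‖ ≤ s := by simpa [K] using hz
  have hw' : ‖w‖ ≤ s := by simpa [K] using hw
  have h := hmin ((hmem (u ε, v ε)).2 ⟨⟨⟨?_, ?_⟩, ?_⟩, sub_ne_zero.1 huv⟩)
  · simp only [mem_ofPred_eq] at h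
    linarith
  · simpa [K] using hu2.le.trans hz'
  · simpa [K] using hv2.le.trans hw'
  · simp only [hu1, hv1, hFzw]

/-- The image is open since `F` is a local diffeomorphism. It is starlike: for `t₁ ≤ 1`, the
least `t ∈ [t₁, 1]` for which `t F(z)` is a value of `F` on `|ζ| ≤ |z|` is `t₁`,
as any larger one can be decreased along an inward path. -/
theorem isStarlikeDomain_image_of_inward {F : ℂ → ℂ} {r : ℝ} (hr : 0 < r) (hF0 : F 0 = 0)
    (hne : ∀ z ∈ ball (0 : ℂ) r, z ≠ 0 → F z ≠ 0)
    (hd : ∀ z ∈ ball (0 : ℂ) r, ∃ L : ℂ ≃L[ℝ] ℂ, HasStrictFDerivAt F (L : ℂ →L[ℝ] ℂ) z ∧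
      (z ≠ 0 → 0 < (L.symm (F z) * conj z).re)) :
    IsStarlikeDomain (F '' ball 0 r) := by
  refine ⟨?_, ⟨0, by simpa using hr, hF0⟩, ?_⟩
  · rw [isOpen_iff_mem_nhds]
    rintro _ ⟨z, hz, rfl⟩
    obtain ⟨L, hL, -⟩ := hd z hz
    rw [← hL.map_nhds_eq_of_equiv]
    exact image_mem_map (isOpen_ball.mem_nhds hz)
  have hcont : ContinuousOn F (ball 0 r) := fun z hz => by
    obtain ⟨L, hL, -⟩ := hd z hz
    exact hL.continuousAt.continuousWithinAt
  rw [starConvex_zero_iff]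
  rintro _ ⟨z, hz, rfl⟩ t₁ ht₁ ht₁'
  rcases eq_or_ne z 0 with rfl | hz0
  · exact ⟨0, hz, by simp [hF0]⟩
  set K := closedBall (0 : ℂ) ‖z‖
  have hKr : K ⊆ ball 0 r := closedBall_subset_ball (by simpa using hz)
  have hcomp : IsCompact (Icc t₁ 1 ×ˢ K) := isCompact_Icc.prod (isCompact_closedBall 0 ‖z‖)
  set S := {p : ℝ × ℂ | p ∈ Icc t₁ 1 ×ˢ K ∧ F p.2 = p.1 • F z}
  have hSclosed : IsClosed S := by
    have h1 : ContinuousOn (fun p : ℝ × ℂ => F p.2 - p.1 • F z) (Icc t₁ 1 ×ˢ K) :=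
      ((hcont.mono hKr).comp continuousOn_snd fun p hp => hp.2).sub (by fun_prop)
    convert h1.preimage_isClosed_of_isClosed hcomp.isClosed (isClosed_singleton (x := 0)) using 1
    ext p
    simp only [S, mem_ofPred_eq, mem_inter_iff, mem_preimage, mem_singleton_iff, sub_eq_zero]
  obtain ⟨⟨t, w⟩, ⟨⟨ht, hw⟩, hFw⟩, hmin⟩ := (hcomp.of_isClosed_subset hSclosed
    fun p hp => hp.1).exists_isMinOn ⟨(1, z), ⟨⟨⟨ht₁', le_rfl⟩, by simp [K]⟩, by simp⟩⟩
    (f := fun p : ℝ × ℂ => p.1) (by fun_prop)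
  dsimp only at ht hw hFw
  rcases ht.1.eq_or_lt with rfl | hlt
  · exact ⟨w, hKr hw, hFw⟩
  exfalso
  have hw0 : w ≠ 0 := by
    rintro rfl
    rw [hF0, eq_comm, smul_eq_zero] at hFw
    exact hFw.elim (ht₁.trans_lt hlt).ne' (hne z hz hz0)
  obtain ⟨L, hL, hLw⟩ := hd w (hKr hw)
  obtain ⟨u, hu, hu'⟩ := exists_inward_path hL (hLw hw0)
  have hlim : Tendsto (fun ε : ℝ => (1 - ε) * t) (𝓝[>] 0) (𝓝 t) := by
    refine Tendsto.mono_left ?_ nhdsWithin_le_nhds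
    exact (by fun_prop : Continuous fun ε : ℝ => (1 - ε) * t).tendsto' 0 t (by simp)
  obtain ⟨ε, hε, ⟨hu1, hu2⟩, hε0⟩ :=
    ((hlim.eventually (lt_mem_nhds hlt)).and (hu'.and self_mem_nhdsWithin)).exists
  have hε0' : (0 : ℝ) < ε := hε0
  have ht0 : 0 < t := ht₁.trans_lt hlt
  have hdec : (1 - ε) * t < t := by nlinarith
  have hw' : ‖w‖ ≤ ‖z‖ := by simpa [K] using hw
  have h := hmin (a := ((1 - ε) * t, u ε)) ⟨⟨⟨hε.le, hdec.le.trans ht.2⟩, ?_⟩, ?_⟩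
  · simp only [mem_ofPred_eq] at h
    linarith
  · simpa [K] using hu2.le.trans hw'
  · simp only [hu1, hFw, smul_smul]

/-! ### Wirtinger derivatives of products of an analytic and an antianalytic factor -/

section Wirtinger

/-- The real-linear map `v ↦ p v + q v̄`, the differential of a map with Wirtinger derivatives
`p` and `q`. -/
noncomputable def wirtingerMap (p q : ℂ) : ℂ →L[ℝ] ℂ :=
  p • ContinuousLinearMap.id ℝ ℂ + q • (Complex.conjCLE : ℂ →L[ℝ] ℂ)

@[simp] lemma wirtingerMap_apply (p q v : ℂ) : wirtingerMap p q v = p * v + q * conj v := by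
  simp [wirtingerMap]

lemma mul_conj_sub_mul_conj_ne_zero {p q : ℂ} (h : ‖q‖ < ‖p‖) :
    p * conj p - q * conj q ≠ 0 := by
  rw [Complex.mul_conj, Complex.mul_conj, Complex.normSq_eq_norm_sq, Complex.normSq_eq_norm_sq]
  have : ‖q‖ ^ 2 < ‖p‖ ^ 2 := by gcongr
  exact_mod_cast (sub_pos.2 this).ne'

/-- For `|q| < |p|` the map `v ↦ p v + q v̄` has the inverse
`w ↦ (p̄ w - q w̄) / (|p|² - |q|²)`. -/
noncomputable def wirtingerEquiv (p q : ℂ) (h : ‖q‖ < ‖p‖) : ℂ ≃L[ℝ] ℂ :=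
  ContinuousLinearEquiv.equivOfInverse (wirtingerMap p q)
    (wirtingerMap (conj p / (p * conj p - q * conj q)) (-q / (p * conj p - q * conj q)))
    (fun v => by
      have := mul_conj_sub_mul_conj_ne_zero h
      simp only [wirtingerMap_apply, map_add, map_mul, Complex.conj_conj]
      linear_combination v * div_self this)
    (fun v => by
      have := mul_conj_sub_mul_conj_ne_zero h
      have h2 : conj p * p - conj q * q ≠ 0 := by rwa [mul_comm, mul_comm (conj q)]
      simp only [wirtingerMap_apply, map_add, map_mul, map_div₀, map_neg, map_sub,
        Complex.conj_conj]
      rw [mul_comm (conj p) p, mul_comm (conj q) q]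
      field_simp
      ring)

lemma wirtingerEquiv_symm_apply (p q : ℂ) (h : ‖q‖ < ‖p‖) (w : ℂ) :
    (wirtingerEquiv p q h).symm w =
      (conj p * w - q * conj w) / (p * conj p - q * conj q) := by
  change wirtingerMap _ _ w = _
  rw [wirtingerMap_apply]
  ring

lemma wirtingerZ_of_hasFDerivAt {f : ℂ → ℂ} {p q z : ℂ} (h : HasFDerivAt f (wirtingerMap p q) z) :
    wirtingerZ f z = p := by
  rw [wirtingerZ, h.fderiv]
  simp only [wirtingerMap_apply, map_one, Complex.conj_I]
  linear_combination (-p / 2 + q / 2) * Complex.I_sq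

lemma wirtingerZbar_of_hasFDerivAt {f : ℂ → ℂ} {p q z : ℂ}
    (h : HasFDerivAt f (wirtingerMap p q) z) : wirtingerZbar f z = q := by
  rw [wirtingerZbar, h.fderiv]
  simp only [wirtingerMap_apply, map_one, Complex.conj_I]
  linear_combination (p / 2 - q / 2) * Complex.I_sq

lemma hasStrictFDerivAt_mul_conj {A B : ℂ → ℂ} {A' B' z : ℂ} (hA : HasStrictDerivAt A A' z)
    (hB : HasStrictDerivAt B B' z) :
    HasStrictFDerivAt (fun z => A z * conj (B z))
      (wirtingerMap (A' * conj (B z)) (A z * conj B')) z := by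
  have h1 := hA.hasStrictFDerivAt.restrictScalars ℝ
  have h2 := (Complex.conjCLE : ℂ →L[ℝ] ℂ).hasStrictFDerivAt.comp z
    (hB.hasStrictFDerivAt.restrictScalars ℝ)
  have h3 : HasStrictFDerivAt (fun z => A z * conj (B z)) _ z := h1.mul h2
  refine h3.congr_fderiv ?_
  ext v
  simp
  ring

variable {f A B : ℂ → ℂ} {s : Set ℂ} {z : ℂ}

lemma hasStrictFDerivAt_of_eqOn (hs : IsOpen s) (hA : DifferentiableOn ℂ A s)
    (hB : DifferentiableOn ℂ B s) (hf : ∀ z ∈ s, f z = A z * conj (B z)) (hz : z ∈ s) :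
    HasStrictFDerivAt f
      (wirtingerMap (deriv A z * conj (B z)) (A z * conj (deriv B z))) z := by
  have h := hasStrictFDerivAt_mul_conj (hA.analyticAt (hs.mem_nhds hz)).hasStrictDerivAt
    (hB.analyticAt (hs.mem_nhds hz)).hasStrictDerivAt
  refine h.congr_of_eventuallyEq ?_
  filter_upwards [hs.mem_nhds hz] with w hw
  exact (hf w hw).symm

lemma contDiffAt_of_eqOn (hs : IsOpen s) (hA : DifferentiableOn ℂ A s)
    (hB : DifferentiableOn ℂ B s) (hf : ∀ z ∈ s, f z = A z * conj (B z)) (hz : z ∈ s) :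
    ContDiffAt ℝ 1 f z := by
  have h1 : ContDiffAt ℝ 1 A z :=
    (hA.analyticAt (hs.mem_nhds hz)).contDiffAt.restrict_scalars ℝ
  have h2 : ContDiffAt ℝ 1 B z :=
    (hB.analyticAt (hs.mem_nhds hz)).contDiffAt.restrict_scalars ℝ
  refine (h1.mul ((Complex.conjCLE : ℂ →L[ℝ] ℂ).contDiff.contDiffAt.comp z h2)).congr_of_eventuallyEq
    ?_
  filter_upwards [hs.mem_nhds hz] with w hw
  exact hf w hw

/-- For `f = A B̄` the equation of logharmonic mappings with dilatation `a` is `B'/B = a A'/A`. -/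
lemma logharmonic_equation_iff (hs : IsOpen s) (hA : DifferentiableOn ℂ A s)
    (hB : DifferentiableOn ℂ B s) (hf : ∀ z ∈ s, f z = A z * conj (B z)) (hz : z ∈ s)
    (hA0 : A z ≠ 0) (hB0 : B z ≠ 0) (c : ℂ) :
    conj (wirtingerZbar f z) / conj (f z) = c * (wirtingerZ f z / f z) ↔
      logDeriv B z = c * logDeriv A z := by
  have h := (hasStrictFDerivAt_of_eqOn hs hA hB hf hz).hasFDerivAt
  have h1 : conj (B z) ≠ 0 := by simpa using hB0
  have h2 : conj (A z) ≠ 0 := by simpa using hA0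
  rw [wirtingerZ_of_hasFDerivAt h, wirtingerZbar_of_hasFDerivAt h, hf z hz, logDeriv_apply,
    logDeriv_apply, map_mul, map_mul, Complex.conj_conj, Complex.conj_conj,
    mul_div_mul_left _ _ h2, mul_div_mul_right _ _ h1]

lemma argDeriv_eq_re (hs : IsOpen s) (hA : DifferentiableOn ℂ A s)
    (hB : DifferentiableOn ℂ B s) (hf : ∀ z ∈ s, f z = A z * conj (B z)) (hz : z ∈ s)
    (hA0 : A z ≠ 0) (hB0 : B z ≠ 0) :
    argDeriv f z = (z * (logDeriv A z - logDeriv B z)).re := by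
  have h := (hasStrictFDerivAt_of_eqOn hs hA hB hf hz).hasFDerivAt
  have h1 : conj (B z) ≠ 0 := by simpa using hB0
  have h2 : (z * (deriv A z * conj (B z)) - conj z * (A z * conj (deriv B z))) /
      (A z * conj (B z)) = z * logDeriv A z - conj (z * logDeriv B z) := by
    rw [logDeriv_apply, logDeriv_apply, map_mul, map_div₀]
    field_simp
  rw [argDeriv, wirtingerZ_of_hasFDerivAt h, wirtingerZbar_of_hasFDerivAt h, hf z hz, h2, mul_sub,
    Complex.sub_re, Complex.sub_re, Complex.conj_re]

lemma isLogharmonic_mul_conj {a : ℂ → ℂ} (hA : DifferentiableOn ℂ A unitDisk)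
    (hB : DifferentiableOn ℂ B unitDisk)
    (h : ∀ z ∈ unitDisk, A z ≠ 0 → B z ≠ 0 → logDeriv B z = a z * logDeriv A z) :
    IsLogharmonic a fun z => A z * conj (B z) := by
  have hs : IsOpen unitDisk := isOpen_ball
  refine ⟨hA.continuousOn.mul (Complex.continuous_conj.comp_continuousOn hB.continuousOn),
    fun z hz hz0 => ⟨contDiffAt_of_eqOn hs hA hB (fun _ _ => rfl) hz, ?_⟩⟩
  have hA0 : A z ≠ 0 := left_ne_zero_of_mul hz0
  have hB0 : B z ≠ 0 := by simpa using right_ne_zero_of_mul hz0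
  exact (logharmonic_equation_iff hs hA hB (fun _ _ => rfl) hz hA0 hB0 _).2 (h z hz hA0 hB0)

/-! ### Starlikeness of logharmonic mappings -/

/-- For a nonvanishing logharmonic `A B̄` with `k = A'/A`, the velocity of the inward path is
`-conj (k (1 - a)) / (|k|² (1 - |a|²))`, and `z k (1 - a)` has positive real part. -/
theorem exists_equiv_of_logharmonic {a : ℂ → ℂ} {r : ℝ} (hA : DifferentiableOn ℂ A (ball 0 r))
    (hB : DifferentiableOn ℂ B (ball 0 r)) (hf : ∀ z ∈ ball 0 r, f z = A z * conj (B z))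
    (ha : ∀ z ∈ ball 0 r, ‖a z‖ < 1) (hA0 : A 0 = 0) (hA'0 : deriv A 0 ≠ 0)
    (hAne : ∀ z ∈ ball 0 r, z ≠ 0 → A z ≠ 0) (hBne : ∀ z ∈ ball 0 r, B z ≠ 0)
    (hAB : ∀ z ∈ ball 0 r, z ≠ 0 → logDeriv B z = a z * logDeriv A z)
    (hre : ∀ z ∈ ball 0 r, z ≠ 0 → 0 < (z * (logDeriv A z - logDeriv B z)).re)
    (hz : z ∈ ball 0 r) :
    ∃ L : ℂ ≃L[ℝ] ℂ, HasStrictFDerivAt f (L : ℂ →L[ℝ] ℂ) z ∧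
      (z ≠ 0 → 0 < (L.symm (f z) * conj z).re) := by
  have hd := hasStrictFDerivAt_of_eqOn isOpen_ball hA hB hf hz
  rcases eq_or_ne z 0 with rfl | hz0
  · have h : ‖A 0 * conj (deriv B 0)‖ < ‖deriv A 0 * conj (B 0)‖ := by
      rw [hA0, zero_mul, norm_zero, norm_pos_iff]
      exact mul_ne_zero hA'0 (by simpa using hBne 0 hz)
    exact ⟨wirtingerEquiv _ _ h, hd, fun h => absurd rfl h⟩
  have hAz := hAne z hz hz0
  have hBz := hBne z hz
  set k := logDeriv A z
  have hk : k ≠ 0 := by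
    intro hk
    have := hre z hz hz0
    rw [hAB z hz hz0] at this
    simp [show logDeriv A z = 0 from hk] at this
  have hA' : deriv A z = A z * k := by
    simp only [k, logDeriv_apply]; field_simp
  have hB' : deriv B z = B z * (a z * k) := by
    rw [← hAB z hz hz0, logDeriv_apply]; field_simp
  have h : ‖A z * conj (deriv B z)‖ < ‖deriv A z * conj (B z)‖ := by
    rw [hA', hB']
    simp only [norm_mul, RCLike.norm_conj]
    have : 0 < ‖A z‖ * ‖B z‖ * ‖k‖ := by positivity
    nlinarith [mul_lt_mul_of_pos_left (ha z hz) this]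
  refine ⟨wirtingerEquiv _ _ h, hd, fun _ => ?_⟩
  have hpos : 0 < ‖k‖ ^ 2 * (1 - ‖a z‖ ^ 2) := by
    have := ha z hz
    have h1 : ‖a z‖ ^ 2 < 1 := by nlinarith [norm_nonneg (a z)]
    have : 0 < ‖k‖ := norm_pos_iff.2 hk
    have := sub_pos.2 h1
    positivity
  have hne : ((‖k‖ ^ 2 * (1 - ‖a z‖ ^ 2) : ℝ) : ℂ) ≠ 0 := by exact_mod_cast hpos.ne'
  have key : (wirtingerEquiv _ _ h).symm (f z) * conj z =
      conj (z * (k - a z * k)) / (‖k‖ ^ 2 * (1 - ‖a z‖ ^ 2) : ℝ) := by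
    have hn : ((‖k‖ ^ 2 * (1 - ‖a z‖ ^ 2) : ℝ) : ℂ) = k * conj k * (1 - a z * conj (a z)) := by
      simp [Complex.mul_conj, Complex.normSq_eq_norm_sq]
    have hA1 : conj (A z) ≠ 0 := by simpa using hAz
    have hB1 : conj (B z) ≠ 0 := by simpa using hBz
    rw [wirtingerEquiv_symm_apply, div_mul_eq_mul_div, div_eq_div_iff (mul_conj_sub_mul_conj_ne_zero h) hne,
      hn, hf z hz, hA', hB']
    simp only [map_mul, map_sub, Complex.conj_conj]
    ring
  rw [key, Complex.div_ofReal_re, Complex.conj_re]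
  have := hre z hz hz0
  rw [hAB z hz hz0] at this
  exact div_pos this hpos

end Wirtinger

/-! ### Functions of positive real part -/

section PositiveRealPart

lemma norm_sub_lt_norm_add_conj {z w : ℂ} (hz : 0 < z.re) (hw : 0 < w.re) :
    ‖z - w‖ < ‖z + conj w‖ := by
  refine lt_of_pow_lt_pow_left₀ 2 (norm_nonneg _) ?_
  rw [← Complex.normSq_eq_norm_sq, ← Complex.normSq_eq_norm_sq, Complex.normSq_apply,
    Complex.normSq_apply]
  simp only [Complex.sub_re, Complex.sub_im, Complex.add_re, Complex.add_im, Complex.conj_re,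
    Complex.conj_im]
  nlinarith [mul_pos hz hw]

lemma add_conj_ne_zero {z w : ℂ} (hz : 0 < z.re) (hw : 0 < w.re) : z + conj w ≠ 0 :=
  norm_pos_iff.1 ((norm_nonneg _).trans_lt (norm_sub_lt_norm_add_conj hz hw))

variable {P : ℂ → ℂ}

/-- The Cayley transform of a function of positive real part, normalised to vanish at `0`,
maps the unit disk to itself. -/
lemma cayley_mapsTo (hP : DifferentiableOn ℂ P (ball 0 1))
    (hre : ∀ z ∈ ball (0 : ℂ) 1, 0 < (P z).re) :
    DifferentiableOn ℂ (fun z => (P z - P 0) / (P z + conj (P 0))) (ball 0 1) ∧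
      MapsTo (fun z => (P z - P 0) / (P z + conj (P 0))) (ball 0 1) (closedBall 0 1) := by
  have h0 := hre 0 (mem_ball_self one_pos)
  refine ⟨(hP.sub_const _).div (hP.add_const _) fun z hz => add_conj_ne_zero (hre z hz) h0,
    fun z hz => ?_⟩
  rw [mem_closedBall_zero_iff, norm_div]
  exact div_le_one_of_le₀ (norm_sub_lt_norm_add_conj (hre z hz) h0).le (norm_nonneg _)

lemma norm_sub_le_of_re_pos (hP : DifferentiableOn ℂ P (ball 0 1))
    (hre : ∀ z ∈ ball (0 : ℂ) 1, 0 < (P z).re) {z : ℂ} (hz : z ∈ ball 0 1) :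
    ‖P z - P 0‖ ≤ ‖z‖ * ‖P z + conj (P 0)‖ := by
  obtain ⟨h1, h2⟩ := cayley_mapsTo hP hre
  have h := Complex.norm_le_norm_of_mapsTo_ball h1 h2 (by simp) (by simpa using hz)
  have hpos := norm_pos_iff.2 (add_conj_ne_zero (hre z hz) (hre 0 (mem_ball_self one_pos)))
  rwa [norm_div, div_le_iff₀ hpos] at h

lemma norm_deriv_zero_le_of_re_pos (hP : DifferentiableOn ℂ P (ball 0 1))
    (hre : ∀ z ∈ ball (0 : ℂ) 1, 0 < (P z).re) : ‖deriv P 0‖ ≤ 2 * (P 0).re := by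
  obtain ⟨h1, h2⟩ := cayley_mapsTo hP hre
  have h0 := hre 0 (mem_ball_self one_pos)
  have hd := (hP.differentiableAt (ball_mem_nhds 0 one_pos)).hasDerivAt
  have hne := add_conj_ne_zero h0 h0
  have h := Complex.norm_deriv_le_one_of_mapsTo_ball h1 (by simpa using h2) one_pos
  have hd' : HasDerivAt (fun z => (P z - P 0) / (P z + conj (P 0))) _ 0 :=
    (hd.sub_const (P 0)).div (hd.add_const (conj (P 0))) hne
  have hval : (deriv P 0 * (P 0 + conj (P 0)) - (P 0 - P 0) * deriv P 0) /
      (P 0 + conj (P 0)) ^ 2 = deriv P 0 / (P 0 + conj (P 0)) := by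
    rw [sub_self, zero_mul, sub_zero, sq, mul_div_mul_right _ _ hne]
  rw [hd'.deriv, hval, norm_div, div_le_one (norm_pos_iff.2 hne), Complex.add_conj,
    Complex.norm_real, Real.norm_of_nonneg (by positivity)] at h
  exact h

/-- The estimate `|p'/p| ≤ 2 / (1 - |z|²)` for functions of positive real part: the bound for
`p' (0)`, moved to `z` by a disk automorphism. -/
lemma norm_logDeriv_mul_le_of_re_pos (hP : DifferentiableOn ℂ P (ball 0 1))
    (hre : ∀ z ∈ ball (0 : ℂ) 1, 0 < (P z).re) {z : ℂ} (hz : z ∈ ball 0 1) :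
    ‖logDeriv P z‖ * (1 - ‖z‖ ^ 2) ≤ 2 := by
  have hz' : ‖z‖ < 1 := by simpa using hz
  have hden : ∀ ζ ∈ ball (0 : ℂ) 1, 1 + conj z * ζ ≠ 0 := fun ζ hζ h => by
    have hζ' : ‖ζ‖ < 1 := by simpa using hζ
    have h1 : conj z * ζ = -1 := by linear_combination h
    have h2 : ‖z‖ * ‖ζ‖ = 1 := by simpa using congrArg norm h1
    nlinarith [norm_nonneg z, norm_nonneg ζ]
  set τ : ℂ → ℂ := fun ζ => (ζ + z) / (1 + conj z * ζ)
  have hτd : DifferentiableOn ℂ τ (ball 0 1) :=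
    DifferentiableOn.div (by fun_prop) (by fun_prop) hden
  have hτm : MapsTo τ (ball 0 1) (ball 0 1) := fun ζ hζ => by
    have hζ' : ‖ζ‖ < 1 := by simpa using hζ
    rw [mem_ball_zero_iff, norm_div, div_lt_one (norm_pos_iff.2 (hden ζ hζ))]
    refine lt_of_pow_lt_pow_left₀ 2 (norm_nonneg _) ?_
    have h1 : ζ.re ^ 2 + ζ.im ^ 2 < 1 := by
      have := Complex.normSq_eq_norm_sq ζ
      rw [Complex.normSq_apply] at this
      nlinarith [norm_nonneg ζ]
    have h2 : z.re ^ 2 + z.im ^ 2 < 1 := by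
      have := Complex.normSq_eq_norm_sq z
      rw [Complex.normSq_apply] at this
      nlinarith [norm_nonneg z]
    rw [← Complex.normSq_eq_norm_sq, ← Complex.normSq_eq_norm_sq, Complex.normSq_apply,
      Complex.normSq_apply]
    simp only [Complex.add_re, Complex.add_im, Complex.mul_re, Complex.mul_im, Complex.conj_re,
      Complex.conj_im, Complex.one_re, Complex.one_im]
    nlinarith [mul_pos (sub_pos.2 h1) (sub_pos.2 h2)]
  have hτ0 : τ 0 = z := by simp [τ]
  have hτ' : HasDerivAt τ (1 - ‖z‖ ^ 2 : ℝ) 0 := by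
    have h1 : HasDerivAt (fun ζ : ℂ => ζ + z) 1 0 := (hasDerivAt_id 0).add_const z
    have h2 : HasDerivAt (fun ζ : ℂ => 1 + conj z * ζ) (conj z) 0 := by
      simpa using ((hasDerivAt_id (0 : ℂ)).const_mul (conj z)).const_add 1
    refine (h1.div h2 (by simp)).congr_deriv ?_
    simp [Complex.mul_conj, Complex.normSq_eq_norm_sq]
  have hPz : HasDerivAt P (deriv P z) (τ 0) := by
    rw [hτ0]
    exact (hP.differentiableAt (isOpen_ball.mem_nhds hz)).hasDerivAt
  have h := norm_deriv_zero_le_of_re_pos (hP.comp hτd hτm) fun ζ hζ => hre _ (hτm hζ)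
  rw [(hPz.comp 0 hτ').deriv, Function.comp_apply, hτ0, norm_mul, Complex.norm_real,
    Real.norm_of_nonneg (by nlinarith [norm_nonneg z])] at h
  have hP0 : 0 < ‖P z‖ := (hre z hz).trans_le (Complex.re_le_norm _)
  rw [logDeriv_apply, norm_div, div_mul_eq_mul_div, div_le_iff₀ hP0]
  linarith [Complex.re_le_norm (P z)]

lemma re_ge_of_re_pos (hP : DifferentiableOn ℂ P (ball 0 1))
    (hre : ∀ z ∈ ball (0 : ℂ) 1, 0 < (P z).re) (h0 : P 0 = 1) {z : ℂ} (hz : z ∈ ball 0 1) :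
    1 - ‖z‖ ≤ (P z).re * (1 + ‖z‖) := by
  have h := norm_sub_le_of_re_pos hP hre hz
  have hr : ‖z‖ < 1 := by simpa using hz
  have hr0 := norm_nonneg z
  set r := ‖z‖
  have hx := hre z hz
  have hsq : ‖P z - P 0‖ ^ 2 ≤ r ^ 2 * ‖P z + conj (P 0)‖ ^ 2 := by
    rw [← mul_pow]; gcongr
  rw [h0, ← Complex.normSq_eq_norm_sq (P z - 1), ← Complex.normSq_eq_norm_sq (P z + _),
    Complex.normSq_apply, Complex.normSq_apply] at hsq
  simp only [Complex.sub_re, Complex.sub_im, Complex.add_re, Complex.add_im, map_one,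
    Complex.one_re, Complex.one_im, sub_zero, add_zero] at hsq
  set x := (P z).re
  set y := (P z).im
  by_contra hlt
  push Not at hlt
  -- The two roots of the quadratic inequality for `x` are `(1 - r) / (1 + r)` and its inverse.
  have h1 : ((1 + r) * x - (1 - r)) * ((1 - r) * x - (1 + r)) ≤ 0 := by
    nlinarith [mul_nonneg (sq_nonneg y) (by nlinarith : 0 ≤ 1 - r ^ 2)]
  have h2 : (1 - r) * x < 1 + r := by nlinarith
  nlinarith [mul_pos (by linarith : 0 < (1 - r) - (1 + r) * x) (sub_pos.2 h2)]

/-- For `Re q > α` and `q(0) = 1` the minimum of `Re q` on `|z| = r` is at least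
`(1 - (1 - 2α) r) / (1 + r)`. -/
lemma re_ge_of_re_gt {q : ℂ → ℂ} {α : ℝ} (hα : α < 1) (hq : DifferentiableOn ℂ q (ball 0 1))
    (hre : ∀ z ∈ ball (0 : ℂ) 1, α < (q z).re) (h0 : q 0 = 1) {z : ℂ} (hz : z ∈ ball 0 1) :
    1 - (1 - 2 * α) * ‖z‖ ≤ (q z).re * (1 + ‖z‖) := by
  have hα' : 0 < 1 - α := sub_pos.2 hα
  have hre' : ∀ z, ((q z - α) / (1 - α : ℝ)).re = ((q z).re - α) / (1 - α) := fun z => by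
    rw [Complex.div_ofReal_re, Complex.sub_re, Complex.ofReal_re]
  have h := re_ge_of_re_pos (P := fun z => (q z - α) / (1 - α : ℝ))
    ((hq.sub_const _).div_const _)
    (fun z hz => by rw [hre']; exact div_pos (sub_pos.2 (hre z hz)) hα')
    (by
      rw [h0, Complex.ofReal_sub, Complex.ofReal_one, div_self]
      exact_mod_cast hα'.ne') hz
  rw [hre', div_mul_eq_mul_div, le_div_iff₀ hα'] at h
  linarith

end PositiveRealPart

/-! ### The radius -/

section Radius

variable {α : ℝ}

lemma radicand_pos (α : ℝ) : 0 < α ^ 2 - 2 * α + 3 := by nlinarith [sq_nonneg (α - 1)]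

lemma one_sub_lt_sqrt (α : ℝ) : 1 - α < √(α ^ 2 - 2 * α + 3) :=
  Real.lt_sqrt_of_sq_lt (by linarith [sq_nonneg α, (by ring : (1 - α) ^ 2 = α ^ 2 - 2 * α + 1)])

/-- Rationalised, the formula for the radius has no exceptional case. -/
lemma rho_eq (hα1 : α < 1) : rho α = 1 / (2 - α + √(α ^ 2 - 2 * α + 3)) := by
  have hs := Real.sq_sqrt (radicand_pos α).le
  have hs0 := Real.sqrt_nonneg (α ^ 2 - 2 * α + 3)
  rw [rho]
  split_ifs with h
  · have : √(α ^ 2 - 2 * α + 3) = 3 / 2 := by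
      rw [h, show ((1 / 2 : ℝ) ^ 2 - 2 * (1 / 2) + 3) = (3 / 2) ^ 2 by norm_num]
      exact Real.sqrt_sq (by norm_num)
    rw [this, h]; norm_num
  · have h1 : 1 - 2 * α ≠ 0 := fun h' => h (by linarith)
    have h2 : 2 - α + √(α ^ 2 - 2 * α + 3) ≠ 0 := by linarith
    rw [div_eq_div_iff h1 h2]
    linear_combination -hs

lemma rho_pos (hα1 : α < 1) : 0 < rho α := by
  rw [rho_eq hα1]
  have hs0 := Real.sqrt_nonneg (α ^ 2 - 2 * α + 3)
  exact one_div_pos.2 (by linarith)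

lemma rho_lt_one (hα1 : α < 1) : rho α < 1 := by
  rw [rho_eq hα1]
  have hs0 := Real.sqrt_nonneg (α ^ 2 - 2 * α + 3)
  rw [div_lt_one (by linarith)]
  linarith

/-- The polynomial `1 - (4 - 2α) r + (1 - 2α) r²`, whose smallest positive root is `ρ`. -/
def radiusPoly (α r : ℝ) : ℝ := 1 - (4 - 2 * α) * r + (1 - 2 * α) * r ^ 2

lemma radiusPoly_eq_mul (α r : ℝ) :
    radiusPoly α r = (1 - (2 - α + √(α ^ 2 - 2 * α + 3)) * r) *
      (1 - (2 - α - √(α ^ 2 - 2 * α + 3)) * r) := by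
  rw [radiusPoly]
  linear_combination (r ^ 2) * Real.sq_sqrt (radicand_pos α).le

lemma radiusPoly_pos (hα1 : α < 1) {r : ℝ} (hr0 : 0 ≤ r) (hr : r < rho α) :
    0 < radiusPoly α r := by
  have hs0 := Real.sqrt_nonneg (α ^ 2 - 2 * α + 3)
  rw [rho_eq hα1, lt_div_iff₀ (by linarith)] at hr
  rw [radiusPoly_eq_mul]
  exact mul_pos (by linarith) (by nlinarith [mul_nonneg hs0 hr0])

lemma radiusPoly_neg (hα1 : α < 1) {r : ℝ} (hr : rho α < r) (hr1 : r < 1) :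
    radiusPoly α r < 0 := by
  have hr0 : 0 < r := (rho_pos hα1).trans hr
  have hs0 := Real.sqrt_nonneg (α ^ 2 - 2 * α + 3)
  rw [rho_eq hα1, div_lt_iff₀ (by linarith)] at hr
  rw [radiusPoly_eq_mul]
  exact mul_neg_of_neg_of_pos (by linarith) (by nlinarith [one_sub_lt_sqrt α])

end Radius

/-! ### Close to starlike mappings are starlike in the disk of radius `ρ` -/

lemma logDeriv_id_mul {h : ℂ → ℂ} {z : ℂ} (hz : z ≠ 0) (hh : h z ≠ 0)
    (hd : DifferentiableAt ℂ h z) :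
    logDeriv (fun z => z * h z) z = z⁻¹ + logDeriv h z := by
  rw [logDeriv_mul (f := fun z => z) z hz hh differentiableAt_fun_id hd, logDeriv_id', one_div]

/-- For `f = z h ḡ` in `ST_Lh(α)` the quotient `z h / g` is starlike of order `α`, so the
classical lower bound for functions of real part greater than `α` applies. -/
lemma re_ge_of_argDeriv_gt {a f h g : ℂ → ℂ} {α : ℝ} (hα : α < 1)
    (hh : DifferentiableOn ℂ h unitDisk) (hg : DifferentiableOn ℂ g unitDisk)
    (hhg : ∀ z ∈ unitDisk, h z * g z ≠ 0) (hf : ∀ z ∈ unitDisk, f z = z * h z * conj (g z))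
    (hlog : IsLogharmonic a f) (harg : ∀ z ∈ unitDisk, z ≠ 0 → α < argDeriv f z)
    {z : ℂ} (hz : z ∈ unitDisk) (hz0 : z ≠ 0) :
    logDeriv g z = a z * (z⁻¹ + logDeriv h z) ∧
      1 - (1 - 2 * α) * ‖z‖ ≤ (z * (z⁻¹ + logDeriv h z - logDeriv g z)).re * (1 + ‖z‖) := by
  have hs : IsOpen unitDisk := isOpen_ball
  have hA : DifferentiableOn ℂ (fun z => z * h z) unitDisk := differentiableOn_id.mul hh
  have hh0 : ∀ z ∈ unitDisk, h z ≠ 0 := fun z hz => left_ne_zero_of_mul (hhg z hz)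
  have hg0 : ∀ z ∈ unitDisk, g z ≠ 0 := fun z hz => right_ne_zero_of_mul (hhg z hz)
  have hL : ∀ z ∈ unitDisk, z ≠ 0 →
      logDeriv (fun z => z * h z) z = z⁻¹ + logDeriv h z := fun z hz hz0 =>
    logDeriv_id_mul hz0 (hh0 z hz) (hh.differentiableAt (hs.mem_nhds hz))
  constructor
  · rw [← hL z hz hz0]
    refine (logharmonic_equation_iff hs hA hg hf hz (mul_ne_zero hz0 (hh0 z hz)) (hg0 z hz) _).1
      (hlog.2 z hz ?_).2
    rw [hf z hz]
    simpa using ⟨⟨hz0, hh0 z hz⟩, hg0 z hz⟩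
  · have hq : ∀ z, z ≠ 0 → z * (z⁻¹ + logDeriv h z - logDeriv g z) =
        1 + z * (logDeriv h z - logDeriv g z) := fun z hz0 => by field_simp; ring
    rw [hq z hz0]
    refine re_ge_of_re_gt (q := fun z => 1 + z * (logDeriv h z - logDeriv g z)) hα ?_ ?_
      (by simp) hz
    · exact (differentiableOn_id.mul (((hh.deriv hs).div hh hh0).sub
        ((hg.deriv hs).div hg hg0))).const_add 1
    · intro w hw
      rcases eq_or_ne w 0 with rfl | hw0
      · simpa using hα
      · rw [← hq w hw0, ← hL w hw hw0,
          ← argDeriv_eq_re hs hA hg hf hw (mul_ne_zero hw0 (hh0 w hw)) (hg0 w hw)]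
        exact harg w hw hw0

/-- For `R = H Ḡ` in `P_Lh` the quotient `H / G` has positive real part. -/
lemma norm_sub_logDeriv_le_of_re_pos {R H G : ℂ → ℂ}
    (hH : DifferentiableOn ℂ H unitDisk) (hG : DifferentiableOn ℂ G unitDisk)
    (hR : ∀ z ∈ unitDisk, R z = H z * conj (G z)) (hre : ∀ z ∈ unitDisk, 0 < (R z).re)
    {z : ℂ} (hz : z ∈ unitDisk) :
    ‖logDeriv H z - logDeriv G z‖ * (1 - ‖z‖ ^ 2) ≤ 2 := by
  have hs : IsOpen unitDisk := isOpen_ball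
  have hR0 : ∀ z ∈ unitDisk, H z ≠ 0 ∧ G z ≠ 0 := fun z hz => by
    have h : R z ≠ 0 := fun h => by simpa [h] using hre z hz
    rw [hR z hz] at h
    exact ⟨left_ne_zero_of_mul h, by simpa using right_ne_zero_of_mul h⟩
  have h := norm_logDeriv_mul_le_of_re_pos (P := fun z => H z / G z)
    (hH.div hG fun z hz => (hR0 z hz).2) (fun w hw => ?_) hz
  · rwa [logDeriv_div z (hR0 z hz).1 (hR0 z hz).2 (hH.differentiableAt (hs.mem_nhds hz))
      (hG.differentiableAt (hs.mem_nhds hz))] at h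
  · have hG0 := (hR0 w hw).2
    have hG1 : conj (G w) ≠ 0 := by simpa using hG0
    have h1 : H w / G w = R w / (‖G w‖ ^ 2 : ℝ) := by
      rw [hR w hw, Complex.ofReal_pow, ← Complex.mul_conj']
      field_simp
    rw [h1, Complex.div_ofReal_re]
    exact div_pos (hre w hw) (by positivity)

theorem injOn_and_isStarlikeDomain_of_mem_CSTLh {α : ℝ} (hα1 : α < 1) {F : ℂ → ℂ}
    (hF : F ∈ CSTLh α) {r : ℝ} (hr0 : 0 < r) (hr : r ≤ rho α) :
    InjOn F (ball 0 r) ∧ IsStarlikeDomain (F '' ball 0 r) := by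
  obtain ⟨a, ⟨-, ha⟩, f, ⟨hflog, -, ⟨h, g, hh, hg, hhg, -, hf⟩, harg⟩, R,
    ⟨hRlog, ⟨H, G, hH, hG, -, -, hR⟩, hre⟩, hFfR⟩ := hF
  have hs : IsOpen unitDisk := isOpen_ball
  have hsub : ball (0 : ℂ) r ⊆ unitDisk := ball_subset_ball (hr.trans (rho_lt_one hα1).le)
  have hh0 : ∀ z ∈ unitDisk, h z ≠ 0 := fun z hz => left_ne_zero_of_mul (hhg z hz)
  have hg0 : ∀ z ∈ unitDisk, g z ≠ 0 := fun z hz => right_ne_zero_of_mul (hhg z hz)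
  have hR0 : ∀ z ∈ unitDisk, R z ≠ 0 := fun z hz h => by simpa [h] using hre z hz
  have hH0 : ∀ z ∈ unitDisk, H z ≠ 0 := fun z hz => by
    have := hR0 z hz
    rw [hR z hz] at this
    exact left_ne_zero_of_mul this
  have hG0 : ∀ z ∈ unitDisk, G z ≠ 0 := fun z hz => by
    have := hR0 z hz
    rw [hR z hz] at this
    simpa using right_ne_zero_of_mul this
  have hda : ∀ {k : ℂ → ℂ}, DifferentiableOn ℂ k unitDisk → ∀ {z}, z ∈ unitDisk →
      DifferentiableAt ℂ k z := fun hk z hz => hk.differentiableAt (hs.mem_nhds hz)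
  have hhH : DifferentiableOn ℂ (fun z => h z * H z) unitDisk := hh.mul hH
  set A : ℂ → ℂ := fun z => z * (h z * H z)
  set B : ℂ → ℂ := fun z => g z * G z
  have hA : DifferentiableOn ℂ A unitDisk := differentiableOn_id.mul (hh.mul hH)
  have hB : DifferentiableOn ℂ B unitDisk := hg.mul hG
  have hFAB : ∀ z ∈ ball 0 r, F z = A z * conj (B z) := fun z hz => by
    rw [hFfR z (hsub hz), hf z (hsub hz), hR z (hsub hz), map_mul]
    ring
  have h0 : (0 : ℂ) ∈ unitDisk := mem_ball_self one_pos
  have hA'0 : HasDerivAt A (h 0 * H 0) 0 := by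
    refine ((hasDerivAt_id (0 : ℂ)).mul (hda hhH h0).hasDerivAt).congr_deriv ?_
    simp
  have hLA : ∀ z ∈ ball 0 r, z ≠ 0 →
      logDeriv A z = (z⁻¹ + logDeriv h z) + logDeriv H z := fun z hz hz0 => by
    have hz := hsub hz
    rw [logDeriv_id_mul (h := fun z => h z * H z) hz0 (mul_ne_zero (hh0 z hz) (hH0 z hz))
      (hda hhH hz),
      logDeriv_mul z (hh0 z hz) (hH0 z hz) (hda hh hz) (hda hH hz), add_assoc]
  have hLB : ∀ z ∈ ball 0 r, logDeriv B z = logDeriv g z + logDeriv G z := fun z hz => by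
    have hz := hsub hz
    rw [logDeriv_mul z (hg0 z hz) (hG0 z hz) (hda hg hz) (hda hG hz)]
  have hAne : ∀ z ∈ ball 0 r, z ≠ 0 → A z ≠ 0 := fun z hz hz0 =>
    mul_ne_zero hz0 (mul_ne_zero (hh0 z (hsub hz)) (hH0 z (hsub hz)))
  have hBne : ∀ z ∈ ball 0 r, B z ≠ 0 := fun z hz =>
    mul_ne_zero (hg0 z (hsub hz)) (hG0 z (hsub hz))
  have hAB : ∀ z ∈ ball 0 r, z ≠ 0 → logDeriv B z = a z * logDeriv A z := fun z hz hz0 => by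
    have h1 := (re_ge_of_argDeriv_gt hα1 hh hg hhg hf hflog harg (hsub hz) hz0).1
    have h2 := (logharmonic_equation_iff hs hH hG hR (hsub hz) (hH0 z (hsub hz))
      (hG0 z (hsub hz)) _).1 (hRlog.2 z (hsub hz) (hR0 z (hsub hz))).2
    rw [hLA z hz hz0, hLB z hz, h1, h2]
    ring
  have hpos : ∀ z ∈ ball 0 r, z ≠ 0 → 0 < (z * (logDeriv A z - logDeriv B z)).re := by
    intro z hz hz0
    have h1 := (re_ge_of_argDeriv_gt hα1 hh hg hhg hf hflog harg (hsub hz) hz0).2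
    have h2 := norm_sub_logDeriv_le_of_re_pos hH hG hR hre (hsub hz)
    have hzr : ‖z‖ < r := by simpa using hz
    have hz1 : ‖z‖ < 1 := by simpa [unitDisk] using hsub hz
    have hz0' := norm_nonneg z
    have h3 := radiusPoly_pos hα1 hz0' (hzr.trans_le hr)
    have h4 := neg_le_of_abs_le
      (Complex.abs_re_le_norm (z * (logDeriv H z - logDeriv G z)))
    rw [norm_mul] at h4
    have hsplit : z * (logDeriv A z - logDeriv B z) =
        z * (z⁻¹ + logDeriv h z - logDeriv g z) + z * (logDeriv H z - logDeriv G z) := by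
      rw [hLA z hz hz0, hLB z hz]
      ring
    rw [hsplit, Complex.add_re]
    have h5 : 0 < 1 - ‖z‖ ^ 2 := by nlinarith
    refine pos_of_mul_pos_left ?_ h5.le
    rw [radiusPoly] at h3
    nlinarith [mul_le_mul_of_nonneg_right h1 (sub_nonneg.2 hz1.le),
      mul_le_mul_of_nonneg_right h4 h5.le, mul_le_mul_of_nonneg_left h2 hz0']
  have hd : ∀ z ∈ ball (0 : ℂ) r, ∃ L : ℂ ≃L[ℝ] ℂ,
      HasStrictFDerivAt F (L : ℂ →L[ℝ] ℂ) z ∧ (z ≠ 0 → 0 < (L.symm (F z) * conj z).re) :=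
    fun z hz => exists_equiv_of_logharmonic (hA.mono hsub) (hB.mono hsub) hFAB
      (fun z hz => ha z (hsub hz)) (by simp [A])
      (by rw [hA'0.deriv]; exact mul_ne_zero (hh0 0 h0) (hH0 0 h0)) hAne hBne hAB hpos hz
  have hF0 : F 0 = 0 := by rw [hFAB 0 (mem_ball_self hr0)]; simp [A]
  have hFne : ∀ z ∈ ball (0 : ℂ) r, z ≠ 0 → F z ≠ 0 := fun z hz hz0 => by
    rw [hFAB z hz]
    exact mul_ne_zero (hAne z hz hz0) (by simpa using hBne z hz)
  exact ⟨injOn_ball_of_inward hF0 hFne hd, isStarlikeDomain_image_of_inward hr0 hF0 hFne hd⟩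

/-! ### The extremal mapping -/

lemma one_sub_ne_zero_of_norm_lt {z : ℂ} (hz : ‖z‖ < 1) : 1 - z ≠ 0 := fun h => by
  rw [← sub_eq_zero.1 h, norm_one] at hz
  exact hz.false

lemma one_add_ne_zero_of_norm_lt {z : ℂ} (hz : ‖z‖ < 1) : 1 + z ≠ 0 := by
  simpa using one_sub_ne_zero_of_norm_lt (z := -z) (by simpa using hz)

lemma re_cayley_pos {z : ℂ} (hz : ‖z‖ < 1) : 0 < ((1 + z) / (1 - z)).re := by
  have h1 : 0 < Complex.normSq (1 - z) :=
    Complex.normSq_pos.2 (one_sub_ne_zero_of_norm_lt hz)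
  have h2 : z.re * z.re + z.im * z.im < 1 := by
    rw [← Complex.normSq_apply, Complex.normSq_eq_norm_sq]
    nlinarith [norm_nonneg z]
  rw [Complex.div_re, ← add_div]
  refine div_pos ?_ h1
  simp only [Complex.add_re, Complex.add_im, Complex.sub_re, Complex.sub_im, Complex.one_re,
    Complex.one_im]
  nlinarith

/-- On the disk every analytic function is the logarithmic derivative of a zero-free analytic
function with value `1` at the origin. -/
lemma exists_logDeriv_eq {k : ℂ → ℂ} (hk : DifferentiableOn ℂ k unitDisk) :
    ∃ g : ℂ → ℂ, DifferentiableOn ℂ g unitDisk ∧ (∀ z, g z ≠ 0) ∧ g 0 = 1 ∧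
      ∀ z ∈ unitDisk, logDeriv g z = k z := by
  obtain ⟨K, hK0, hK⟩ := (DifferentiableOn.isExactOn_ball hk).with_val_at 0 0
  have hg : ∀ z ∈ unitDisk, HasDerivAt (fun z => Complex.exp (K z)) (Complex.exp (K z) * k z) z :=
    fun z hz => (hK z hz).cexp
  refine ⟨fun z => Complex.exp (K z), fun z hz => (hg z hz).differentiableAt.differentiableWithinAt,
    fun z => Complex.exp_ne_zero _, by simp [hK0], fun z hz => ?_⟩
  rw [logDeriv_apply, (hg z hz).deriv, mul_div_cancel_left₀ _ (Complex.exp_ne_zero _)]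

/-- The factor `(1 - z)^{-(2 - 2α)}` of the Koebe function of order `α`, with the principal
branch. -/
noncomputable def koebeFactor (α : ℝ) (z : ℂ) : ℂ :=
  Complex.exp (-(2 - 2 * α : ℝ) * Complex.log (1 - z))

lemma koebeFactor_ne_zero (α : ℝ) (z : ℂ) : koebeFactor α z ≠ 0 := Complex.exp_ne_zero _

lemma hasDerivAt_koebeFactor (α : ℝ) {z : ℂ} (hz : z ∈ unitDisk) :
    HasDerivAt (koebeFactor α) (koebeFactor α z * ((2 - 2 * α : ℝ) / (1 - z))) z := by
  have hz' : ‖z‖ < 1 := by simpa [unitDisk] using hz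
  have hslit : 1 - z ∈ Complex.slitPlane := by
    left
    rw [Complex.sub_re, Complex.one_re]
    linarith [Complex.re_le_norm z]
  have h := ((((hasDerivAt_id z).const_sub 1).clog hslit).const_mul
    (-(2 - 2 * α : ℝ) : ℂ)).cexp
  refine h.congr_deriv ?_
  simp only [koebeFactor, id]
  ring

lemma koebeFactor_ofReal (α : ℝ) {x : ℝ} (hx : x ≤ 1) :
    koebeFactor α x = (Real.exp (-(2 - 2 * α) * Real.log (1 - x)) : ℝ) := by
  rw [koebeFactor]
  push_cast
  rw [Complex.ofReal_log (by linarith)]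
  push_cast
  rfl

/-- The Koebe function `z / (1 - z)^{2 - 2α}` of order `α` is `z h / g` for a mapping `z h ḡ` in
`ST_Lh(α)` with prescribed dilatation `a`. The dilatation forces
`g' / g = a / (z (1 - a)) · (1 + (1 - 2α) z) / (1 - z)`, which is analytic as `a(0) = 0`. -/
lemma exists_mem_STLh {a : ℂ → ℂ} {α : ℝ} (hα0 : 0 ≤ α) (hα1 : α < 1) (ha : a ∈ classB) (ha0 : a 0 = 0) :
    ∃ h g : ℂ → ℂ, DifferentiableOn ℂ h unitDisk ∧ DifferentiableOn ℂ g unitDisk ∧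
      (∀ z, g z ≠ 0) ∧ (∀ z, h z = g z * koebeFactor α z) ∧
      (∀ z ∈ unitDisk, z ≠ 0 → logDeriv g z = a z * (z⁻¹ + logDeriv h z)) ∧
      (∀ z ∈ unitDisk, z ≠ 0 → z * (z⁻¹ + logDeriv h z - logDeriv g z) =
        (1 + (1 - 2 * α : ℝ) * z) / (1 - z)) ∧
      (fun z => z * h z * conj (g z)) ∈ STLh a α := by
  obtain ⟨had, ha1⟩ := ha
  have hs : IsOpen unitDisk := isOpen_ball
  have hnorm : ∀ z ∈ unitDisk, ‖z‖ < 1 := fun z hz => by simpa [unitDisk] using hz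
  have h0 : (0 : ℂ) ∈ unitDisk := mem_ball_self one_pos
  set q : ℂ → ℂ := fun z => (1 + (1 - 2 * α : ℝ) * z) / (1 - z)
  have hq : DifferentiableOn ℂ q unitDisk :=
    DifferentiableOn.div (by fun_prop) (by fun_prop)
      fun z hz => one_sub_ne_zero_of_norm_lt (hnorm z hz)
  have hb : DifferentiableOn ℂ (dslope a 0) unitDisk :=
    (Complex.differentiableOn_dslope (hs.mem_nhds h0)).2 had
  obtain ⟨g, hg, hg0, hg1, hgL⟩ := exists_logDeriv_eq (k := fun z => dslope a 0 z * q z / (1 - a z))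
    ((hb.mul hq).div (had.const_sub 1) fun z hz => one_sub_ne_zero_of_norm_lt (ha1 z hz))
  have hE : DifferentiableOn ℂ (koebeFactor α) unitDisk := fun z hz =>
    (hasDerivAt_koebeFactor α hz).differentiableAt.differentiableWithinAt
  set h : ℂ → ℂ := fun z => g z * koebeFactor α z
  have hh : DifferentiableOn ℂ h unitDisk := hg.mul hE
  have hh0 : ∀ z, h z ≠ 0 := fun z => mul_ne_zero (hg0 z) (koebeFactor_ne_zero α z)
  have hLh : ∀ z ∈ unitDisk, logDeriv h z = logDeriv g z + (2 - 2 * α : ℝ) / (1 - z) :=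
    fun z hz => by
      rw [logDeriv_mul z (hg0 z) (koebeFactor_ne_zero α z) (hg.differentiableAt (hs.mem_nhds hz))
        (hE.differentiableAt (hs.mem_nhds hz)), logDeriv_apply (koebeFactor α),
        (hasDerivAt_koebeFactor α hz).deriv, mul_div_cancel_left₀ _ (koebeFactor_ne_zero α z)]
  have hdiff : ∀ z ∈ unitDisk, z ≠ 0 → z * (z⁻¹ + logDeriv h z - logDeriv g z) = q z :=
    fun z hz hz0 => by
      have := one_sub_ne_zero_of_norm_lt (hnorm z hz)
      rw [hLh z hz]
      simp only [q]
      field_simp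
      push_cast
      ring
  have hdil : ∀ z ∈ unitDisk, z ≠ 0 → logDeriv g z = a z * (z⁻¹ + logDeriv h z) :=
    fun z hz hz0 => by
      have h1 := one_sub_ne_zero_of_norm_lt (ha1 z hz)
      have h2 : z * logDeriv g z * (1 - a z) = a z * q z := by
        rw [hgL z hz, dslope_of_ne a hz0, slope_def_field, ha0]
        field_simp
        ring
      rw [← hdiff z hz hz0] at h2
      refine mul_left_cancel₀ hz0 ?_
      linear_combination h2
  have hA : DifferentiableOn ℂ (fun z => z * h z) unitDisk := differentiableOn_id.mul hh
  have hLA : ∀ z ∈ unitDisk, z ≠ 0 → logDeriv (fun z => z * h z) z = z⁻¹ + logDeriv h z :=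
    fun z hz hz0 => logDeriv_id_mul hz0 (hh0 z) (hh.differentiableAt (hs.mem_nhds hz))
  have hre : ∀ z ∈ unitDisk, z ≠ 0 →
      α < (z * (logDeriv (fun z => z * h z) z - logDeriv g z)).re := fun z hz hz0 => by
    rw [hLA z hz hz0, hdiff z hz hz0]
    have hz1 := hnorm z hz
    have h1 := one_sub_ne_zero_of_norm_lt hz1
    have h2 : q z = α + (1 - α : ℝ) * ((1 + z) / (1 - z)) := by
      simp only [q]
      field_simp
      push_cast
      ring
    rw [h2, Complex.add_re, Complex.ofReal_re, Complex.re_ofReal_mul]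
    linarith [mul_pos (sub_pos.2 hα1) (re_cayley_pos hz1)]
  have hA'0 : HasDerivAt (fun z => z * h z) (h 0) 0 := by
    refine ((hasDerivAt_id (0 : ℂ)).mul
      (hh.differentiableAt (hs.mem_nhds h0)).hasDerivAt).congr_deriv ?_
    simp
  refine ⟨h, g, hh, hg, hg0, fun _ => rfl, hdil, hdiff, ?_, ?_,
    ⟨h, g, hh, hg, fun z _ => mul_ne_zero (hh0 z) (hg0 z), hg1, fun _ _ => rfl⟩, ?_⟩
  · refine isLogharmonic_mul_conj hA hg fun z hz hz' _ => ?_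
    have hz0 : z ≠ 0 := left_ne_zero_of_mul hz'
    rw [hLA z hz hz0, hdil z hz hz0]
  · refine injOn_ball_of_inward (by simp) (fun z _ hz0 => ?_) fun z hz =>
      exists_equiv_of_logharmonic (a := a) hA hg (fun _ _ => rfl) ha1 (by simp)
        (by rw [hA'0.deriv]; exact hh0 0) (fun z _ hz0 => mul_ne_zero hz0 (hh0 z))
        (fun z _ => hg0 z) (fun z hz hz0 => by rw [hLA z hz hz0, hdil z hz hz0])
        (fun z hz hz0 => ?_) hz
    · exact mul_ne_zero (mul_ne_zero hz0 (hh0 z)) (by simpa using hg0 z)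
    · exact hα0.trans_lt (hre z hz hz0)
  · intro z hz hz0
    rw [argDeriv_eq_re hs hA hg (fun _ _ => rfl) hz (mul_ne_zero hz0 (hh0 z)) (hg0 z)]
    exact hre z hz hz0

/-- The function `p = (1 + z) / (1 - z)` is `H / G` for a mapping `H Ḡ` in `P_Lh` with prescribed
dilatation `a`. -/
lemma exists_mem_PLh {a : ℂ → ℂ} (ha : a ∈ classB) :
    ∃ H G : ℂ → ℂ, DifferentiableOn ℂ H unitDisk ∧ DifferentiableOn ℂ G unitDisk ∧
      (∀ z, G z ≠ 0) ∧ (∀ z, H z = G z * ((1 + z) / (1 - z))) ∧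
      (∀ z ∈ unitDisk, logDeriv G z = a z * logDeriv H z) ∧
      (∀ z ∈ unitDisk, logDeriv H z - logDeriv G z = 2 / (1 - z ^ 2)) ∧
      (fun z => H z * conj (G z)) ∈ PLh a := by
  obtain ⟨had, ha1⟩ := ha
  have hs : IsOpen unitDisk := isOpen_ball
  have hnorm : ∀ z ∈ unitDisk, ‖z‖ < 1 := fun z hz => by simpa [unitDisk] using hz
  have hsq : ∀ z ∈ unitDisk, 1 - z ^ 2 ≠ 0 := fun z hz => by
    rw [show 1 - z ^ 2 = (1 + z) * (1 - z) by ring]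
    exact mul_ne_zero (one_add_ne_zero_of_norm_lt (hnorm z hz))
      (one_sub_ne_zero_of_norm_lt (hnorm z hz))
  obtain ⟨G, hG, hG0, hG1, hGL⟩ := exists_logDeriv_eq
    (k := fun z => a z / (1 - a z) * (2 / (1 - z ^ 2)))
    ((had.div (had.const_sub 1) fun z hz => one_sub_ne_zero_of_norm_lt (ha1 z hz)).mul
      (DifferentiableOn.div (by fun_prop) (by fun_prop) hsq))
  set p : ℂ → ℂ := fun z => (1 + z) / (1 - z)
  have hp' : ∀ z ∈ unitDisk, HasDerivAt p
      ((1 * (1 - z) - (1 + z) * (-1)) / (1 - z) ^ 2) z := fun z hz =>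
    ((hasDerivAt_id z).const_add 1).div ((hasDerivAt_id z).const_sub 1)
      (one_sub_ne_zero_of_norm_lt (hnorm z hz))
  have hp0 : ∀ z ∈ unitDisk, p z ≠ 0 := fun z hz =>
    div_ne_zero (one_add_ne_zero_of_norm_lt (hnorm z hz)) (one_sub_ne_zero_of_norm_lt (hnorm z hz))
  have hp : DifferentiableOn ℂ p unitDisk := fun z hz =>
    (hp' z hz).differentiableAt.differentiableWithinAt
  have hpL : ∀ z ∈ unitDisk, logDeriv p z = 2 / (1 - z ^ 2) := fun z hz => by
    have h1 := one_sub_ne_zero_of_norm_lt (hnorm z hz)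
    have h2 := one_add_ne_zero_of_norm_lt (hnorm z hz)
    have h3 := hsq z hz
    rw [logDeriv_apply, (hp' z hz).deriv, div_div, div_eq_div_iff _ h3]
    · simp only [p]
      field_simp
      ring
    · exact mul_ne_zero (pow_ne_zero 2 h1) (hp0 z hz)
  set H : ℂ → ℂ := fun z => G z * p z
  have hH : DifferentiableOn ℂ H unitDisk := hG.mul hp
  have hHL : ∀ z ∈ unitDisk, logDeriv H z = logDeriv G z + 2 / (1 - z ^ 2) := fun z hz => by
    rw [← hpL z hz, logDeriv_mul z (hG0 z) (hp0 z hz) (hG.differentiableAt (hs.mem_nhds hz))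
      (hp.differentiableAt (hs.mem_nhds hz))]
  have hdil : ∀ z ∈ unitDisk, logDeriv G z = a z * logDeriv H z := fun z hz => by
    have h1 := one_sub_ne_zero_of_norm_lt (ha1 z hz)
    have h3 := hsq z hz
    rw [hHL z hz, hGL z hz]
    field_simp
    ring
  refine ⟨H, G, hH, hG, hG0, fun _ => rfl, hdil, fun z hz => by rw [hHL z hz]; ring,
    isLogharmonic_mul_conj hH hG fun z hz _ _ => hdil z hz,
    ⟨H, G, hH, hG, by simp [H, p, hG1], hG1, fun _ _ => rfl⟩, fun z hz => ?_⟩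
  have h1 : H z * conj (G z) = (‖G z‖ ^ 2 : ℝ) * p z := by
    rw [Complex.ofReal_pow, ← Complex.mul_conj']
    simp only [H]
    ring
  have hG2 : 0 < ‖G z‖ := norm_pos_iff.2 (hG0 z)
  simp only [h1, Complex.re_ofReal_mul]
  exact mul_pos (by positivity) (re_cayley_pos (hnorm z hz))

/-- A real function whose derivative takes both signs on an interval is not injective there. -/
lemma not_injOn_Ioo_of_hasDerivAt {m : ℝ → ℝ} {c d s t m₁ m₂ : ℝ}
    (hm : ContinuousOn m (Ioo c d)) (hs : s ∈ Ioo c d) (ht : t ∈ Ioo c d)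
    (hms : HasDerivAt m m₁ s) (hmt : HasDerivAt m m₂ t) (h₁ : m₁ < 0) (h₂ : 0 < m₂) :
    ¬ InjOn m (Ioo c d) := by
  intro hinj
  have hds := derivWithin_of_isOpen (f := m) isOpen_Ioo hs
  have hdt := derivWithin_of_isOpen (f := m) isOpen_Ioo ht
  rw [hms.deriv] at hds
  rw [hmt.deriv] at hdt
  rcases hm.strictMonoOn_of_injOn_Ioo (hs.1.trans hs.2) hinj with h | h
  · have := h.monotoneOn.derivWithin_nonneg (x := s)
    linarith
  · have := h.antitoneOn.derivWithin_nonpos (x := t)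
    linarith

/-- The extremal mapping `F` is real and negative on the negative axis, and the derivative of
`t ↦ F (-t)` has the sign of `-radiusPoly`, which changes at `t = ρ`. -/
theorem exists_mem_CSTLhWith_not_injOn {a : ℂ → ℂ} {α : ℝ} (hα0 : 0 ≤ α) (hα1 : α < 1) (ha : a ∈ classB)
    (ha0 : a 0 = 0) :
    ∃ F ∈ CSTLhWith a α, ∀ r : ℝ, rho α < r → r ≤ 1 → ¬ InjOn F (ball 0 r) := by
  obtain ⟨h, g, hh, hg, hg0, hhg, hdil, hq, hf⟩ := exists_mem_STLh hα0 hα1 ha ha0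
  obtain ⟨H, G, hH, hG, hG0, hHG, hdil', hp, hR⟩ := exists_mem_PLh ha
  refine ⟨fun z => (z * h z * conj (g z)) * (H z * conj (G z)),
    ⟨_, hf, _, hR, fun _ _ => rfl⟩, fun r hr hr1 hinj => ?_⟩
  have hs : IsOpen unitDisk := isOpen_ball
  set F : ℂ → ℂ := fun z => (z * h z * conj (g z)) * (H z * conj (G z))
  have hhH : DifferentiableOn ℂ (fun z => h z * H z) unitDisk := hh.mul hH
  set A : ℂ → ℂ := fun z => z * (h z * H z)
  set B : ℂ → ℂ := fun z => g z * G z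
  have hA : DifferentiableOn ℂ A unitDisk := differentiableOn_id.mul hhH
  have hB : DifferentiableOn ℂ B unitDisk := hg.mul hG
  have hFAB : ∀ z ∈ unitDisk, F z = A z * conj (B z) := fun z _ => by
    simp only [F, A, B, map_mul]
    ring
  have hmem : ∀ t ∈ Ioo (0 : ℝ) 1, (-t : ℂ) ∈ unitDisk := fun t ht => by
    simpa [unitDisk, abs_of_pos ht.1] using ht.2
  set μ : ℝ → ℝ := fun t => Real.exp (-(2 - 2 * α) * Real.log (1 + t)) * ((1 - t) / (1 + t)) *
    ‖g (-t)‖ ^ 2 * ‖G (-t)‖ ^ 2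
  have hFt : ∀ t ∈ Ioo (0 : ℝ) 1, F (-t) = ((-t * μ t : ℝ) : ℂ) := fun t ht => by
    have hK := koebeFactor_ofReal α (x := -t) (by linarith [ht.1])
    rw [sub_neg_eq_add, Complex.ofReal_neg] at hK
    have h1 : F (-t) = -t * koebeFactor α (-t) * ((1 + -t) / (1 - -t)) *
        (g (-t) * conj (g (-t))) * (G (-t) * conj (G (-t))) := by
      simp only [F, hhg, hHG]
      ring
    rw [h1, hK, Complex.mul_conj', Complex.mul_conj']
    simp only [μ]
    push_cast
    ring
  have hμ : ∀ t ∈ Ioo (0 : ℝ) 1, 0 < μ t := fun t ht => by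
    have h1 : 0 < (1 - t) / (1 + t) := div_pos (sub_pos.2 ht.2) (by linarith [ht.1])
    have h2 : 0 < ‖g (-t)‖ := norm_pos_iff.2 (hg0 _)
    have h3 : 0 < ‖G (-t)‖ := norm_pos_iff.2 (hG0 _)
    have h4 := Real.exp_pos (-(2 - 2 * α) * Real.log (1 + t))
    positivity
  have hderiv : ∀ t ∈ Ioo (0 : ℝ) 1, HasDerivAt (fun t : ℝ => (F (-t)).re)
      (-radiusPoly α t * (μ t / (1 - t ^ 2) * ((1 + a (-t)) / (1 - a (-t))).re)) t := by
    intro t ht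
    have hz := hmem t ht
    have hz0 : (-t : ℂ) ≠ 0 := by simpa using ht.1.ne'
    have hhH0 : h (-t) ≠ 0 ∧ H (-t) ≠ 0 := by
      have := hFt t ht
      have h2 : F (-t) ≠ 0 := by
        rw [this]
        exact_mod_cast (mul_neg_of_neg_of_pos (neg_neg_of_pos ht.1) (hμ t ht)).ne
      exact ⟨fun h => h2 (by simp [F, h]), fun h => h2 (by simp [F, h])⟩
    set z : ℂ := -t with hzdef
    have hda : ∀ {k : ℂ → ℂ}, DifferentiableOn ℂ k unitDisk → DifferentiableAt ℂ k z :=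
      fun hk => hk.differentiableAt (hs.mem_nhds hz)
    have hLA : logDeriv A z = z⁻¹ + logDeriv h z + logDeriv H z := by
      rw [logDeriv_id_mul (h := fun z => h z * H z) hz0 (mul_ne_zero hhH0.1 hhH0.2) (hda hhH),
        logDeriv_mul z hhH0.1 hhH0.2 (hda hh) (hda hH), add_assoc]
    have hLB : logDeriv B z = logDeriv g z + logDeriv G z :=
      logDeriv_mul z (hg0 z) (hG0 z) (hda hg) (hda hG)
    have hA0 : A z ≠ 0 := mul_ne_zero hz0 (mul_ne_zero hhH0.1 hhH0.2)
    have hB0 : B z ≠ 0 := mul_ne_zero (hg0 z) (hG0 z)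
    have ha1 := one_sub_ne_zero_of_norm_lt (ha.2 z hz)
    set k := logDeriv A z
    have hBk : logDeriv B z = a z * k := by
      rw [hLB, hLA, hdil z hz hz0, hdil' z hz]
      ring
    have ht2 : 1 - t ^ 2 ≠ 0 := by nlinarith [ht.1, ht.2]
    have hkval : k * (1 - a z) = ((-radiusPoly α t / (t * (1 - t ^ 2)) : ℝ) : ℂ) := by
      have h1 : z * (k * (1 - a z)) =
          (1 + (1 - 2 * α : ℝ) * z) / (1 - z) + z * (2 / (1 - z ^ 2)) := by
        rw [← hq z hz hz0, ← hp z hz]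
        linear_combination z * hLA - z * (hBk.symm.trans hLB)
      have ht1 : (1 + t : ℂ) ≠ 0 := by
        have : (1 + t) ≠ 0 := by linarith [ht.1]
        exact_mod_cast this
      have ht3 : (1 - (t : ℂ) ^ 2) ≠ 0 := by exact_mod_cast ht2
      have ht0 : (t : ℂ) ≠ 0 := by exact_mod_cast ht.1.ne'
      refine mul_left_cancel₀ hz0 (h1.trans ?_)
      rw [hzdef, sub_neg_eq_add, neg_sq, radiusPoly]
      push_cast
      field_simp
      ring
    have hd := (hasStrictFDerivAt_of_eqOn hs hA hB hFAB hz).hasFDerivAt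
    have hneg : HasDerivAt (fun t : ℝ => (-t : ℂ)) (-1) t := by
      refine (Complex.ofRealCLM.hasDerivAt (x := t)).neg.congr_deriv ?_
      simp
    have hcomp := Complex.reCLM.hasFDerivAt.comp_hasDerivAt t (hd.comp_hasDerivAt t hneg)
    refine hcomp.congr_deriv ?_
    have hval : wirtingerMap (deriv A z * conj (B z)) (A z * conj (deriv B z)) (-1) =
        ((t * μ t : ℝ) : ℂ) * (k + conj (a z * k)) := by
      have h1 : deriv A z = A z * k := by
        simp only [k, logDeriv_apply]
        field_simp
      have h2 : deriv B z = B z * (a z * k) := by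
        rw [← hBk, logDeriv_apply]
        field_simp
      have h3 : ((t * μ t : ℝ) : ℂ) = -(A z * conj (B z)) := by
        rw [← hFAB z hz, hFt t ht]
        push_cast
        ring
      rw [h3, h1, h2, wirtingerMap_apply]
      simp only [map_mul, map_neg, map_one]
      ring
    have hsum : k + a z * k =
        ((-radiusPoly α t / (t * (1 - t ^ 2)) : ℝ) : ℂ) * ((1 + a z) / (1 - a z)) := by
      rw [← hkval]
      field_simp
    have hre := congrArg Complex.re hsum
    rw [Complex.re_ofReal_mul, Complex.add_re] at hre
    rw [hval, Complex.reCLM_apply, Complex.re_ofReal_mul, Complex.add_re, Complex.conj_re, hre]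
    have := ht.1.ne'
    field_simp
  have hfac : ∀ t ∈ Ioo (0 : ℝ) 1,
      0 < μ t / (1 - t ^ 2) * ((1 + a (-t)) / (1 - a (-t))).re := fun t ht =>
    mul_pos (div_pos (hμ t ht) (by nlinarith [ht.1, ht.2])) (re_cayley_pos (ha.2 _ (hmem t ht)))
  have hρ := rho_pos hα1
  have hsub : Ioo 0 r ⊆ Ioo (0 : ℝ) 1 := Ioo_subset_Ioo_right hr1
  have hs₁ : rho α / 2 ∈ Ioo 0 r := ⟨by linarith, by linarith⟩
  have hs₂ : (rho α + r) / 2 ∈ Ioo 0 r := ⟨by linarith, by linarith⟩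
  refine not_injOn_Ioo_of_hasDerivAt
    (fun t ht => (hderiv t (hsub ht)).continuousAt.continuousWithinAt) hs₁ hs₂
    (hderiv _ (hsub hs₁)) (hderiv _ (hsub hs₂)) ?_ ?_ fun x hx y hy hxy => ?_
  · exact mul_neg_of_neg_of_pos
      (neg_neg_of_pos (radiusPoly_pos hα1 hs₁.1.le (by linarith))) (hfac _ (hsub hs₁))
  · exact mul_pos (neg_pos.2 (radiusPoly_neg hα1 (by linarith) (hsub hs₂).2)) (hfac _ (hsub hs₂))
  · have h1 : F (-x) = F (-y) := by
      rw [hFt x (hsub hx), hFt y (hsub hy)] at hxy ⊢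
      rw [Complex.ofReal_re, Complex.ofReal_re] at hxy
      rw [hxy]
    have h2 := hinj (by simpa [abs_of_pos hx.1] using hx.2)
      (by simpa [abs_of_pos hy.1] using hy.2) h1
    exact_mod_cast neg_injective h2

end Logharmonic

theorem mainTheorem2 (α : ℝ) (hα0 : 0 ≤ α) (hα1 : α < 1) :
    (∀ F ∈ Logharmonic.CSTLh α, ∀ r : ℝ, 0 < r → r ≤ Logharmonic.rho α →
      Set.InjOn F (Metric.ball 0 r) ∧
        Logharmonic.IsStarlikeDomain (F '' Metric.ball 0 r)) ∧
    (∀ a ∈ Logharmonic.classB, a 0 = 0 →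
      ∃ F ∈ Logharmonic.CSTLhWith a α, ∀ r : ℝ, Logharmonic.rho α < r → r ≤ 1 →
        ¬ Set.InjOn F (Metric.ball 0 r)) :=
  ⟨fun _ hF _ hr0 hr => Logharmonic.injOn_and_isStarlikeDomain_of_mem_CSTLh hα1 hF hr0 hr,
    fun _ ha ha0 => Logharmonic.exists_mem_CSTLhWith_not_injOn hα0 hα1 ha ha0⟩
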